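/- Let $a\neq b$ be two lines in the plane (possibly parallel), and let $T_a,T_b$ be the reflections in them. Let $K\subset\mathbb R^2$ be a bounded open set, not necessarily connected, that lies strictly on one side of $a$ and strictly on one side of $b$, and whose boundary meets both $a$ and $b$. For $c\in\{a,b\}$ let $\partial_cK$ be the open edge of $K$ on $c$, i.e. the set of points of $c$ that are interior to $K\cup T_cK\cup c$. Put $\partial_0K=\partial K\setminus(\partial_aK\cup\partial_bK)$, and let $\partial_{0,D}K\subset\partial_0K$ be any subset, $\partial_{0,N}K=\partial_0K\setminus\partial_{0,D}K$. For $n\ge1$ let $K_{2^n}$ be the flat surface with boundary obtained from a chain of $2^n$ copies of $K$, every copy being the mirror image of the preceding one (thus $2^{n-1}$ copies of $K$ alternating with $2^{n-1}$ copies of $T_aK$, starting with $K$), by gluing the first copy to the second along $\partial_aK$, the second to the third along $\partial_bK$, the third to the fourth along $\partial_aK$, and so on. The edge $\partial_bK$ of the first copy and the edge $\partial_bK$ of the last copy remain free. Let $K'_{2^n}$ be the surface obtained in the same way with the roles of $a$ and $b$ exchanged, so that $2^{n-1}$ copies of $K$ alternate with $2^{n-1}$ copies of $T_bK$, and the edge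 $\partial_aK$ of the first and of the last copy remains free. On each of the two surfaces consider the Laplacian $-\Delta$ (defined by its quadratic form) with the Dirichlet condition on the free edge of the first copy and on $\partial_{0,D}K$ in every copy, and the Neumann condition on the free edge of the last copy and on $\partial_{0,N}K$ in every copy. Denote its spectrum by $\sigma_{DN}$. Then for every $n\ge1$ $$\sigma_{DN}(K_{2^n})=\sigma_{DN}(K'_{2^n}),$$ and every $\lambda\in\mathbb R$ has the same multiplicity (dimension of the eigenspace, which is $0$ if $\lambda$ is not an eigenvalue) for the two problems. In particular, $\sigma_{DN}(K_4)=\sigma_{DN}(K'_4)$. -/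

import Mathlib

open MeasureTheory TopologicalSpace
open scoped ContDiff ENNReal

noncomputable section

namespace MixedSpectrum

/-- The Euclidean plane. -/
abbrev Plane := EuclideanSpace ℝ (Fin 2)

/-! ### Weak gradients and first-order Sobolev functions on a planar set -/

/-- `u` is square integrable on the (open) set `U`, and the square integrable vector field `F` is its
weak gradient on `U`: `∫ u ∂ᵥφ = - ∫ ⟨F, v⟩ φ` for every smooth `φ` with compact support in `U` and
every direction `v`. So `u ∈ H¹(U)` and `F = ∇u`. -/
def IsSobolevPair (U : Set Plane) (u : Plane → ℝ) (F : Plane → Plane) : Prop :=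
  MemLp u 2 (volume.restrict U) ∧ MemLp F 2 (volume.restrict U) ∧
    ∀ φ : Plane → ℝ, ContDiff ℝ ∞ φ → HasCompactSupport φ → tsupport φ ⊆ U → ∀ v : Plane,
      ∫ x in U, u x * fderiv ℝ φ x v = - ∫ x in U, inner ℝ (F x) v * φ x

theorem IsSobolevPair.zero (U : Set Plane) : IsSobolevPair U (fun _ => 0) (fun _ => 0) := by
  refine ⟨MemLp.zero, MemLp.zero, ?_⟩
  intro φ _ _ _ v
  simp

theorem IsSobolevPair.congr {U : Set Plane} {u u' : Plane → ℝ} {F F' : Plane → Plane}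
    (h : IsSobolevPair U u F) (hu : u =ᵐ[volume.restrict U] u')
    (hF : F =ᵐ[volume.restrict U] F') : IsSobolevPair U u' F' := by
  refine ⟨(memLp_congr_ae hu).1 h.1, (memLp_congr_ae hF).1 h.2.1, ?_⟩
  intro φ h1 h2 h3 v
  have e1 : ∫ x in U, u' x * fderiv ℝ φ x v = ∫ x in U, u x * fderiv ℝ φ x v :=
    integral_congr_ae (hu.mono fun x hx => congrArg (fun t => t * fderiv ℝ φ x v) hx.symm)
  have e2 : ∫ x in U, inner ℝ (F' x) v * φ x = ∫ x in U, inner ℝ (F x) v * φ x :=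
    integral_congr_ae (hF.mono fun x hx => congrArg (fun t => inner ℝ t v * φ x) hx.symm)
  rw [e1, e2, h.2.2 φ h1 h2 h3 v]

theorem IsSobolevPair.smul {U : Set Plane} {u : Plane → ℝ} {F : Plane → Plane}
    (r : ℝ) (h : IsSobolevPair U u F) :
    IsSobolevPair U (fun x => r * u x) (fun x => r • F x) := by
  refine ⟨h.1.const_mul r, h.2.1.const_smul r, ?_⟩
  intro φ h1 h2 h3 v
  have := h.2.2 φ h1 h2 h3 v
  simp only [inner_smul_left, mul_assoc, integral_const_mul, this]
  simp

theorem IsSobolevPair.add {U : Set Plane} {u u' : Plane → ℝ} {F F' : Plane → Plane}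
    (h : IsSobolevPair U u F) (h' : IsSobolevPair U u' F') :
    IsSobolevPair U (fun x => u x + u' x) (fun x => F x + F' x) := by
  refine ⟨h.1.add h'.1, h.2.1.add h'.2.1, ?_⟩
  intro φ h1 h2 h3 v
  have e := h.2.2 φ h1 h2 h3 v
  have e' := h'.2.2 φ h1 h2 h3 v
  have hd : MemLp (fun x => fderiv ℝ φ x v) 2 (volume.restrict U) := by
    refine Continuous.memLp_of_hasCompactSupport ?_ ?_
    · exact (h1.continuous_fderiv (by simp)).clm_apply continuous_const
    · exact h2.fderiv_apply (𝕜 := ℝ) v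
  have hp : MemLp φ 2 (volume.restrict U) :=
    h1.continuous.memLp_of_hasCompactSupport h2
  have i1 : Integrable (fun x => u x * fderiv ℝ φ x v) (volume.restrict U) := h.1.integrable_mul hd
  have i2 : Integrable (fun x => u' x * fderiv ℝ φ x v) (volume.restrict U) :=
    h'.1.integrable_mul hd
  have i3 : Integrable (fun x => inner ℝ (F x) v * φ x) (volume.restrict U) :=
    (h.2.1.inner_const v).integrable_mul hp
  have i4 : Integrable (fun x => inner ℝ (F' x) v * φ x) (volume.restrict U) :=
    (h'.2.1.inner_const v).integrable_mul hp
  simp only [inner_add_left, add_mul]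
  rw [integral_add i1 i2, integral_add i3 i4, e, e']
  ring

/-- A square integrable function on `K` together with a square integrable vector field on `K`
(its gradient, once it lies in `sobolevSpace K`). The product topology is the one of the
`H¹`-norm. -/
abbrev SheetField (K : Opens Plane) :=
  Lp ℝ 2 (volume.restrict (K : Set Plane)) × Lp Plane 2 (volume.restrict (K : Set Plane))

/-- The Sobolev space `H¹(K)`, as the space of pairs `(u, ∇u)`. -/
def sobolevSpace (K : Opens Plane) : Submodule ℝ (SheetField K) where
  carrier := {p | IsSobolevPair K p.1 p.2}
  zero_mem' := (IsSobolevPair.zero (K : Set Plane)).congr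
    (Lp.coeFn_zero ℝ 2 (volume.restrict (K : Set Plane))).symm
    (Lp.coeFn_zero Plane 2 (volume.restrict (K : Set Plane))).symm
  add_mem' := fun {p q} hp hq => (IsSobolevPair.add hp hq).congr
    (Lp.coeFn_add p.1 q.1).symm (Lp.coeFn_add p.2 q.2).symm
  smul_mem' := fun r p hp => (IsSobolevPair.smul r hp).congr
    (Lp.coeFn_smul r p.1).symm (Lp.coeFn_smul r p.2).symm

/-- The functions in `H¹(K)` that vanish almost everywhere on `U ∩ K` for some open neighbourhood
`U` of `Γ`. -/
def vanishingNear (K : Opens Plane) (Γ : Set Plane) : Submodule ℝ (SheetField K) where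
  carrier := {p | p ∈ sobolevSpace K ∧ ∃ U : Set Plane, IsOpen U ∧ Γ ⊆ U ∧
    ∀ᵐ x ∂(volume.restrict (K : Set Plane)), x ∈ U → p.1 x = 0}
  zero_mem' := ⟨zero_mem _, Set.univ, isOpen_univ, Set.subset_univ _, by
    filter_upwards [Lp.coeFn_zero ℝ 2 (volume.restrict (K : Set Plane))] with x hx _ using hx⟩
  add_mem' := by
    rintro p q ⟨hp, U, hU, hΓ, h⟩ ⟨hq, U', hU', hΓ', h'⟩
    refine ⟨add_mem hp hq, U ∩ U', hU.inter hU', Set.subset_inter hΓ hΓ', ?_⟩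
    filter_upwards [h, h', Lp.coeFn_add p.1 q.1] with x h1 h2 h3 hx
    have : (p + q).1 x = p.1 x + q.1 x := h3
    rw [this, h1 hx.1, h2 hx.2, add_zero]
  smul_mem' := by
    rintro r p ⟨hp, U, hU, hΓ, h⟩
    refine ⟨(sobolevSpace K).smul_mem r hp, U, hU, hΓ, ?_⟩
    filter_upwards [h, Lp.coeFn_smul r p.1] with x h1 h3 hx
    have : (r • p).1 x = r * p.1 x := h3
    rw [this, h1 hx, mul_zero]

/-- The functions in `H¹(K)` with the Dirichlet condition `u = 0` on the part `Γ` of the boundary of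
`K`: the closure in `H¹(K)` of the functions that vanish near `Γ`. For `Γ = ∂K` this is `H¹₀(K)`,
for `Γ = ∅` it is `H¹(K)`. -/
def sobolevVanishing (K : Opens Plane) (Γ : Set Plane) : Submodule ℝ (SheetField K) :=
  (vanishingNear K Γ).topologicalClosure

/-! ### Reflections and gluing along a line -/

/-- The reflection `T_c` of the plane in the line `c`. -/
def refl (c : AffineSubspace ℝ Plane) [Nonempty c] : Plane → Plane :=
  EuclideanGeometry.reflection c

/-- The open edge `∂_c K` of `K` on the line `c`: the points of `c` around which `K`, `T_c K` and `c`
fill a whole disc. -/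
def openEdge (c : AffineSubspace ℝ Plane) [Nonempty c] (K : Opens Plane) : Set Plane :=
  {p | p ∈ c ∧ p ∈ interior ((K : Set Plane) ∪ refl c '' K ∪ c)}

/-- The planar domain obtained by gluing `K` and its mirror image `T_c K` along the open edge
`∂_c K`. -/
def doubled (c : AffineSubspace ℝ Plane) [Nonempty c] (K : Opens Plane) : Set Plane :=
  (K : Set Plane) ∪ openEdge c K ∪ refl c '' K

/-- The function on `K ∪ T_c K` equal to `f` on `K` and to `g ∘ T_c` on `T_c K`. -/
def glueFun (c : AffineSubspace ℝ Plane) [Nonempty c] (K : Set Plane) (f g : Plane → ℝ) :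
    Plane → ℝ :=
  fun x => K.indicator f x + K.indicator g (refl c x)

/-- The vector field on `K ∪ T_c K` equal to `F` on `K` and on `T_c K` to the mirror image of `G`;
if `F = ∇f` and `G = ∇g` on `K`, it is the gradient of `glueFun c K f g` on each of `K`, `T_c K`. -/
def glueGrad (c : AffineSubspace ℝ Plane) [Nonempty c] (K : Set Plane) (F G : Plane → Plane) :
    Plane → Plane :=
  fun x => K.indicator F x + c.direction.reflection (K.indicator G (refl c x))

/-- `p` on `K` and `q` on the mirror image `T_c K` (`q` is given after pulling back to `K` by
`T_c`) form together one `H¹` function on the doubled domain. -/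
def GluesAlong (c : AffineSubspace ℝ Plane) [Nonempty c] (K : Opens Plane) (p q : SheetField K) :
    Prop :=
  IsSobolevPair (doubled c K) (glueFun c K p.1 q.1) (glueGrad c K p.2 q.2)

theorem measurePreserving_refl (c : AffineSubspace ℝ Plane) [Nonempty c] :
    MeasurePreserving (refl c) (volume : Measure Plane) volume := by
  have h1 := (measurePreserving_sub_right (volume : Measure Plane)
    ((Classical.arbitrary c : c) : Plane))
  have h2 := (c.direction.reflection).measurePreserving
  have h3 := (measurePreserving_add_right (volume : Measure Plane)
    ((Classical.arbitrary c : c) : Plane))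
  exact h3.comp (h2.comp h1)

theorem indicator_congr {α : Type*} [Zero α] {K : Opens Plane} {f g : Plane → α}
    (h : f =ᵐ[volume.restrict (K : Set Plane)] g) :
    (K : Set Plane).indicator f =ᵐ[volume] (K : Set Plane).indicator g := by
  have h' := (ae_restrict_iff' K.isOpen.measurableSet).1 h
  filter_upwards [h'] with x hx
  by_cases hK : x ∈ (K : Set Plane)
  · simp [hK, hx hK]
  · simp [hK]

theorem glueFun_congr {c : AffineSubspace ℝ Plane} [Nonempty c] {K : Opens Plane}
    {f f' g g' : Plane → ℝ} (hf : f =ᵐ[volume.restrict (K : Set Plane)] f')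
    (hg : g =ᵐ[volume.restrict (K : Set Plane)] g') :
    glueFun c K f g =ᵐ[volume] glueFun c K f' g' := by
  filter_upwards [indicator_congr hf,
    (measurePreserving_refl c).quasiMeasurePreserving.ae (indicator_congr hg)] with x h1 h2
  simp only [glueFun, h1, h2]

theorem glueGrad_congr {c : AffineSubspace ℝ Plane} [Nonempty c] {K : Opens Plane}
    {F F' G G' : Plane → Plane} (hF : F =ᵐ[volume.restrict (K : Set Plane)] F')
    (hG : G =ᵐ[volume.restrict (K : Set Plane)] G') :
    glueGrad c K F G =ᵐ[volume] glueGrad c K F' G' := by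
  filter_upwards [indicator_congr hF,
    (measurePreserving_refl c).quasiMeasurePreserving.ae (indicator_congr hG)] with x h1 h2
  simp only [glueGrad, h1, h2]

theorem GluesAlong.zero (c : AffineSubspace ℝ Plane) [Nonempty c] (K : Opens Plane) :
    GluesAlong c K 0 0 := by
  have e1 := Lp.coeFn_zero ℝ 2 (volume.restrict (K : Set Plane))
  have e2 := Lp.coeFn_zero Plane 2 (volume.restrict (K : Set Plane))
  refine (IsSobolevPair.zero (doubled c K)).congr (ae_restrict_of_ae ?_) (ae_restrict_of_ae ?_)
  · filter_upwards [glueFun_congr (c := c) e1 e1] with x hx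
    exact (hx.trans (by simp [glueFun])).symm
  · filter_upwards [glueGrad_congr (c := c) e2 e2] with x hx
    exact (hx.trans (by simp [glueGrad])).symm

theorem GluesAlong.add {c : AffineSubspace ℝ Plane} [Nonempty c] {K : Opens Plane}
    {p q p' q' : SheetField K} (h : GluesAlong c K p q) (h' : GluesAlong c K p' q') :
    GluesAlong c K (p + p') (q + q') := by
  refine (IsSobolevPair.add h h').congr (ae_restrict_of_ae ?_) (ae_restrict_of_ae ?_)
  · filter_upwards [glueFun_congr (c := c) (Lp.coeFn_add p.1 p'.1) (Lp.coeFn_add q.1 q'.1)]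
      with x hx
    refine Eq.symm (hx.trans ?_)
    simp only [glueFun, Set.indicator_add']
    simp only [Pi.add_apply]
    ring
  · filter_upwards [glueGrad_congr (c := c) (Lp.coeFn_add p.2 p'.2) (Lp.coeFn_add q.2 q'.2)]
      with x hx
    refine Eq.symm (hx.trans ?_)
    simp only [glueGrad, Set.indicator_add']
    simp only [Pi.add_apply, map_add]
    abel

theorem GluesAlong.smul {c : AffineSubspace ℝ Plane} [Nonempty c] {K : Opens Plane}
    {p q : SheetField K} (r : ℝ) (h : GluesAlong c K p q) : GluesAlong c K (r • p) (r • q) := by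
  refine (IsSobolevPair.smul r h).congr (ae_restrict_of_ae ?_) (ae_restrict_of_ae ?_)
  · filter_upwards [glueFun_congr (c := c) (Lp.coeFn_smul r p.1) (Lp.coeFn_smul r q.1)]
      with x hx
    refine Eq.symm (hx.trans ?_)
    have key : ∀ (f : Plane → ℝ) (y : Plane),
        (K : Set Plane).indicator (r • f) y = r * (K : Set Plane).indicator f y := fun f y => by
      by_cases hy : y ∈ (K : Set Plane) <;> simp [Set.indicator, hy]
    simp only [glueFun, key, mul_add]
  · filter_upwards [glueGrad_congr (c := c) (Lp.coeFn_smul r p.2) (Lp.coeFn_smul r q.2)]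
      with x hx
    refine Eq.symm (hx.trans ?_)
    have key : ∀ (f : Plane → Plane) (y : Plane),
        (K : Set Plane).indicator (r • f) y = r • (K : Set Plane).indicator f y := fun f y => by
      by_cases hy : y ∈ (K : Set Plane) <;> simp [Set.indicator, hy]
    simp only [glueGrad, key, smul_add, map_smul]

/-! ### Construction blocks and chains -/

/-- `K` is a bounded open set in a sector formed by two distinct lines `a` and `b` (or in the strip
between them, if they are parallel), whose boundary meets both lines. -/
structure IsConstructionBlock (a b : AffineSubspace ℝ Plane) (K : Opens Plane) : Prop where
  line_left : Module.finrank ℝ a.direction = 1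
  line_right : Module.finrank ℝ b.direction = 1
  ne : a ≠ b
  bounded : Bornology.IsBounded (K : Set Plane)
  sameSide : ∀ x ∈ K, ∀ y ∈ K, a.SSameSide x y ∧ b.SSameSide x y
  meets_left : (frontier (K : Set Plane) ∩ a).Nonempty
  meets_right : (frontier (K : Set Plane) ∩ b).Nonempty

/-- The part of the boundary of `K` away from the open edges on `a` and `b`. -/
def freeBoundary (a b : AffineSubspace ℝ Plane) [Nonempty a] [Nonempty b] (K : Opens Plane) :
    Set Plane :=
  frontier (K : Set Plane) \ (openEdge a K ∪ openEdge b K)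

/-- The form domain of the mixed problem on the chain of `L` copies `0, …, L - 1` of the block `K`,
every copy being the mirror image of the preceding one: copies `j` and `j + 1` are glued along
their edges `∂_c K` if `j` is even and along their edges `∂_d K` if `j` is odd. The chain starts
with `K` itself, whose edge `∂_d K` remains free; for even `L` the other free edge is the edge
`∂_d K` of the last copy.

A function on the chain is a family `w j` of functions with gradients on the copies, all pulled back
to `K`. It belongs to `H¹` of the chain (a flat surface, covered by the isometric images of the
doubled domains of consecutive copies) iff it is `H¹` on each of these doubled domains. The
Dirichlet condition is imposed on the part `D` of the boundary in every copy and on the free edge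
`∂_d K` of copy `0`, there in the form that the extension by zero across the edge is `H¹`.
On all other parts of the boundary, among them the free edge of the last copy, the Neumann
condition is the natural one and restricts no function of the form domain. -/
def chainFormDomain (c d : AffineSubspace ℝ Plane) [Nonempty c] [Nonempty d] (K : Opens Plane)
    (D : Set Plane) (L : ℕ) : Submodule ℝ (Fin L → SheetField K) where
  carrier := {w | (∀ j, w j ∈ sobolevVanishing K D) ∧
    (∀ i j : Fin L, (j : ℕ) = i + 1 → Even (i : ℕ) → GluesAlong c K (w i) (w j)) ∧
    (∀ i j : Fin L, (j : ℕ) = i + 1 → Odd (i : ℕ) → GluesAlong d K (w i) (w j)) ∧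
    (∀ i : Fin L, (i : ℕ) = 0 → GluesAlong d K (w i) 0)}
  zero_mem' := ⟨fun _ => zero_mem _, fun _ _ _ _ => GluesAlong.zero c K,
    fun _ _ _ _ => GluesAlong.zero d K, fun _ _ => GluesAlong.zero d K⟩
  add_mem' := by
    rintro w w' ⟨h1, h2, h3, h4⟩ ⟨h1', h2', h3', h4'⟩
    refine ⟨fun j => add_mem (h1 j) (h1' j), fun i j e p => (h2 i j e p).add (h2' i j e p),
      fun i j e p => (h3 i j e p).add (h3' i j e p), fun i e => ?_⟩
    have := (h4 i e).add (h4' i e)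
    rwa [add_zero] at this
  smul_mem' := by
    rintro r w ⟨h1, h2, h3, h4⟩
    refine ⟨fun j => Submodule.smul_mem _ r (h1 j), fun i j e p => (h2 i j e p).smul r,
      fun i j e p => (h3 i j e p).smul r, fun i e => ?_⟩
    have := (h4 i e).smul r
    rwa [smul_zero] at this

/-! ### The spectrum of the Laplacian with a given form domain -/

/-- The Dirichlet form `∫ ∇u · ∇v`, summed over the copies. -/
def energy {K : Opens Plane} {L : ℕ} (u v : Fin L → SheetField K) : ℝ :=
  ∑ j, inner ℝ (u j).2 (v j).2

/-- The `L²` inner product `∫ f g`, summed over the copies. -/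
def mass {K : Opens Plane} {L : ℕ}
    (f g : Fin L → Lp ℝ 2 (volume.restrict (K : Set Plane))) : ℝ :=
  ∑ j, inner ℝ (f j) (g j)

/-- `u` is the weak solution with form domain `V` of `-Δ u - l u = f`. -/
def IsWeakSolution {K : Opens Plane} {L : ℕ} (V : Submodule ℝ (Fin L → SheetField K)) (l : ℝ)
    (f : Fin L → Lp ℝ 2 (volume.restrict (K : Set Plane))) (u : Fin L → SheetField K) : Prop :=
  u ∈ V ∧ ∀ v ∈ V, energy u v - l * mass (fun j => (u j).1) (fun j => (v j).1)
    = mass f (fun j => (v j).1)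

/-- The spectrum of the self-adjoint operator `-Δ` with form domain `V`: the `l` for which `-Δ - l`
is not a bijection from the domain of the operator onto `L²`. -/
def laplaceSpectrum {K : Opens Plane} {L : ℕ} (V : Submodule ℝ (Fin L → SheetField K)) : Set ℝ :=
  {l | ¬ ∀ f, ∃! u, IsWeakSolution V l f u}

/-- The eigenspace of `-Δ` with form domain `V` for `l` (zero if `l` is not an eigenvalue). -/
def eigenspace {K : Opens Plane} {L : ℕ} (V : Submodule ℝ (Fin L → SheetField K)) (l : ℝ) :
    Submodule ℝ (Fin L → SheetField K) where
  carrier := {u | IsWeakSolution V l 0 u}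
  zero_mem' := ⟨zero_mem _, fun v _ => by simp [energy, mass]⟩
  add_mem' := by
    rintro u u' ⟨h, e⟩ ⟨h', e'⟩
    refine ⟨add_mem h h', fun v hv => ?_⟩
    have := e v hv
    have := e' v hv
    simp only [energy, mass, Pi.add_apply, Prod.fst_add, Prod.snd_add, inner_add_left,
      Finset.sum_add_distrib, Pi.zero_apply, inner_zero_left, Finset.sum_const_zero] at *
    linarith
  smul_mem' := by
    rintro r u ⟨h, e⟩
    refine ⟨V.smul_mem r h, fun v hv => ?_⟩
    have := e v hv
    simp only [energy, mass, Pi.smul_apply, Prod.smul_fst, Prod.smul_snd, real_inner_smul_left,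
      ← Finset.mul_sum, Pi.zero_apply, inner_zero_left, Finset.sum_const_zero] at *
    linear_combination r * this

/-- Multiplicity of `l` as an eigenvalue: the dimension of the eigenspace. -/
def multiplicity {K : Opens Plane} {L : ℕ} (V : Submodule ℝ (Fin L → SheetField K)) (l : ℝ) :
    Cardinal :=
  Module.rank ℝ (eigenspace V l)

end MixedSpectrum

end

noncomputable section

namespace MixedSpectrum

/-! ### Matrices acting on families -/

section MatrixAction

variable {M : Type*} [AddCommGroup M] [Module ℝ M] {L : ℕ}

/-! This is a transplantation proof. Write a function on the chain of `L = 2 ^ n` copies as the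
family `w` of its restrictions, all pulled back to `K`. Let `A` send `w` to the family with entries
`w (i + 1) + w (i - 1)`, where `w (-1) = -w 0` at the Dirichlet end and `w L = w (L - 1)` at the
Neumann end. Then `(A w) i - (A w) (i + 1) = (w (i - 1) - w i) + (w (i + 1) - w (i + 2))`, so the
jump of the new family at one edge is made of the old jumps at the two neighbouring edges, which are
of the other type. Hence `A` exchanges gluing along `a` and along `b`, and the two end conventions
take care of the end conditions (`isChain_pathMatrix_iff`).

This requires that gluing depend only on differences. The even reflection of an `H¹` function is
`H¹` (`IsSobolevPair.even_reflection`), so `q` always glues to itself, and `p` glues to `q` exactly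
when the extension of `p - q` by zero across the edge is `H¹` (`gluesAlong_iff_sub_mem`). No traces
and no regularity of the boundary are needed.

Finally, `A` is symmetric and, for even `L`, invertible. Its coefficients are constant, so it acts
alike on functions and gradients and can be moved from one argument of the energy and mass forms to
the other. As it maps each form domain onto the other, `u` solves the first problem with right side
`f` iff `A u` solves the second with right side `A f`. Unique solvability and eigenspaces therefore
correspond. -/

/-- The action of a real matrix on families of elements of a real vector space. -/
def matrixAct (A : Matrix (Fin L) (Fin L) ℝ) : (Fin L → M) →ₗ[ℝ] (Fin L → M) where
  toFun w i := ∑ j, A i j • w j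
  map_add' w w' := by
    ext i
    simp [smul_add, Finset.sum_add_distrib]
  map_smul' r w := by
    ext i
    simp [Finset.smul_sum, smul_comm r]

theorem matrixAct_apply (A : Matrix (Fin L) (Fin L) ℝ) (w : Fin L → M) (i : Fin L) :
    matrixAct A w i = ∑ j, A i j • w j := rfl

theorem matrixAct_mul (A B : Matrix (Fin L) (Fin L) ℝ) (w : Fin L → M) :
    matrixAct (A * B) w = matrixAct A (matrixAct B w) := by
  ext i
  simp only [matrixAct_apply, Matrix.mul_apply, Finset.sum_smul, Finset.smul_sum, mul_smul]
  exact Finset.sum_comm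

theorem matrixAct_one (w : Fin L → M) : matrixAct (1 : Matrix (Fin L) (Fin L) ℝ) w = w := by
  ext i
  simp [matrixAct_apply, Matrix.one_apply]

/-- The action of an invertible matrix as a linear equivalence. -/
def matrixActEquiv {A : Matrix (Fin L) (Fin L) ℝ} (hA : IsUnit A) :
    (Fin L → M) ≃ₗ[ℝ] (Fin L → M) :=
  LinearEquiv.ofLinearMap (matrixAct A) (matrixAct (hA.unit⁻¹ : (Matrix (Fin L) (Fin L) ℝ)ˣ).1)
    (LinearMap.ext fun w => by
      rw [LinearMap.comp_apply, ← matrixAct_mul, hA.mul_val_inv, matrixAct_one, LinearMap.id_apply])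
    (LinearMap.ext fun w => by
      rw [LinearMap.comp_apply, ← matrixAct_mul, hA.val_inv_mul, matrixAct_one, LinearMap.id_apply])

theorem matrixActEquiv_apply {A : Matrix (Fin L) (Fin L) ℝ} (hA : IsUnit A) (w : Fin L → M) :
    matrixActEquiv hA w = matrixAct A w := rfl

theorem matrixAct_mem (A : Matrix (Fin L) (Fin L) ℝ) {H : Submodule ℝ M} {w : Fin L → M}
    (hw : ∀ i, w i ∈ H) (i : Fin L) : matrixAct A w i ∈ H := by
  rw [matrixAct_apply]
  exact H.sum_mem fun j _ => H.smul_mem _ (hw j)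

theorem matrixAct_mem_iff {A : Matrix (Fin L) (Fin L) ℝ} (hA : IsUnit A) {H : Submodule ℝ M}
    {w : Fin L → M} : (∀ i, matrixAct A w i ∈ H) ↔ ∀ i, w i ∈ H := by
  refine ⟨fun h => ?_, fun h => matrixAct_mem A h⟩
  have e : w = matrixAct (hA.unit⁻¹ : (Matrix (Fin L) (Fin L) ℝ)ˣ).1 (matrixAct A w) :=
    ((matrixActEquiv hA).symm_apply_apply w).symm
  rw [e]
  exact matrixAct_mem _ h

theorem sum_inner_matrixAct {E : Type*} [NormedAddCommGroup E] [InnerProductSpace ℝ E]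
    {A : Matrix (Fin L) (Fin L) ℝ} (hA : A.IsSymm) (f g : Fin L → E) :
    ∑ i, inner ℝ (matrixAct A f i) (g i) = ∑ i, inner ℝ (f i) (matrixAct A g i) := by
  simp only [matrixAct_apply, sum_inner, inner_sum, real_inner_smul_left, real_inner_smul_right]
  rw [Finset.sum_comm]
  exact Finset.sum_congr rfl fun i _ => Finset.sum_congr rfl fun j _ => by rw [hA.apply]

end MatrixAction

/-! ### The transplantation matrix -/

/-- The adjacency matrix of a path of `L` vertices with a loop of weight `-1` at the first and
a loop of weight `1` at the last vertex. -/
def pathMatrix (L : ℕ) : Matrix (Fin L) (Fin L) ℝ := fun i j =>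
  (if (j : ℕ) = (if (i : ℕ) + 1 < L then (i : ℕ) + 1 else i) then 1 else 0) +
    (if (j : ℕ) = (i : ℕ) - 1 then (if (i : ℕ) = 0 then -1 else 1) else 0)

theorem pathMatrix_isSymm (L : ℕ) : (pathMatrix L).IsSymm := by
  ext ⟨i, hi⟩ ⟨j, hj⟩
  simp only [Matrix.transpose_apply, pathMatrix]
  split_ifs <;> first | omega | norm_num

/-! ### The path matrix exchanges the two gluing patterns -/

section Chain

variable {M : Type*} [AddCommGroup M] [Module ℝ M] {L : ℕ}

/-- The truncated `0 - 1 = 0` encodes the Dirichlet convention `w (-1) = -w 0`; the first `if`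
encodes the Neumann convention `w L = w (L - 1)`. -/
theorem matrixAct_pathMatrix (w : ℕ → M) (i : Fin L) :
    matrixAct (pathMatrix L) (fun j => w j) i =
      w (if (i : ℕ) + 1 < L then (i : ℕ) + 1 else i) +
        (if (i : ℕ) = 0 then -1 else 1 : ℝ) • w ((i : ℕ) - 1) := by
  have key : ∀ (m : ℕ) (hm : m < L) (r : ℝ),
      ∑ j : Fin L, (if (j : ℕ) = m then r else 0) • w j = r • w m := by
    intro m hm r
    rw [Finset.sum_eq_single ⟨m, hm⟩]
    · simp
    · intro j _ hj
      rw [if_neg (fun h => hj (Fin.ext h)), zero_smul]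
    · simp
  simp only [matrixAct_apply, pathMatrix, add_smul, Finset.sum_add_distrib]
  rw [key _ (by split_ifs <;> omega), key _ (by omega), one_smul]

theorem exists_nat_extension {M : Type*} [AddCommGroup M] {L : ℕ} (w : Fin L → M) : ∃ W : ℕ → M, w = fun j : Fin L => W j :=
  ⟨fun i => if h : i < L then w ⟨i, h⟩ else 0, by ext j; simp⟩

/-- For a kernel vector, the equations from the Dirichlet end on force `W (2 * k + 1) = W (2 * k)`.
For even `L` the last two entries form such a pair, and the last equation says that their sum is
zero; so they vanish, and the recursion carries zero back to the start. For odd `L` the matrix is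
singular. -/
theorem pathMatrix_isUnit (hL : Even L) : IsUnit (pathMatrix L) := by
  rw [← Matrix.mulVec_injective_iff_isUnit]
  refine (injective_iff_map_eq_zero (pathMatrix L).mulVecLin).2 fun w hw => ?_
  obtain ⟨W, rfl⟩ := exists_nat_extension w
  obtain ⟨m, rfl⟩ := hL
  have h : ∀ i (hi : i < m + m), W (if i + 1 < m + m then i + 1 else i) +
      (if i = 0 then -1 else 1 : ℝ) • W (i - 1) = 0 := fun i hi => by
    rw [← matrixAct_pathMatrix W ⟨i, hi⟩]
    exact congrFun hw ⟨i, hi⟩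
  have h1 : ∀ k, 2 * k + 1 < m + m → W (2 * k + 1) = W (2 * k) := by
    intro k
    induction k with
    | zero =>
      intro hk
      have := h 0 (by omega)
      simp only [zero_add, if_pos (show 1 < m + m by omega), if_true, smul_eq_mul] at this
      simp at this ⊢
      linarith
    | succ k ih =>
      intro hk
      have e := ih (by omega)
      have e1 := h (2 * k + 1) (by omega)
      have e2 := h (2 * k + 2) (by omega)
      simp only [if_pos (show 2 * k + 1 + 1 < m + m by omega)] at e1
      simp only [if_pos (show 2 * k + 2 + 1 < m + m by omega)] at e2
      simp at e1 e2
      rw [show 2 * (k + 1) + 1 = 2 * k + 2 + 1 by ring, show 2 * (k + 1) = 2 * k + 1 + 1 by ring]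
      linarith
  -- Here `k` counts the pairs from the Neumann end.
  have h2 : ∀ k < m, W (2 * (m - 1 - k)) = 0 := by
    intro k
    induction k with
    | zero =>
      intro hk
      have e := h (2 * (m - 1) + 1) (by omega)
      have e1 := h1 (m - 1) (by omega)
      rw [if_neg (by omega)] at e
      simp at e
      simp
      linarith
    | succ k ih =>
      intro hk
      have e := ih (by omega)
      obtain ⟨t, ht⟩ : ∃ t, m - 1 - (k + 1) = t := ⟨_, rfl⟩
      rw [show m - 1 - k = t + 1 by omega] at e
      rw [ht]
      have e1 := h (2 * t + 1) (by omega)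
      rw [if_pos (by omega)] at e1
      simp at e1
      rw [show 2 * (t + 1) = 2 * t + 1 + 1 by ring] at e
      linarith
  ext ⟨i, hi⟩
  have h3 : W (2 * (i / 2)) = 0 := by
    have := h2 (m - 1 - i / 2) (by omega)
    rwa [show m - 1 - (m - 1 - i / 2) = i / 2 by omega] at this
  rcases Nat.even_or_odd' i with ⟨k, rfl | rfl⟩
  · rwa [show 2 * k / 2 = k by omega] at h3
  · rw [show (2 * k + 1) / 2 = k by omega] at h3
    exact (h1 k hi).trans h3

/-- The matching conditions on a chain, for the differences of consecutive entries. -/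
structure IsChain (H C D : Submodule ℝ M) (w : Fin L → M) : Prop where
  mem : ∀ j, w j ∈ H
  even : ∀ i j : Fin L, (j : ℕ) = i + 1 → Even (i : ℕ) → w i - w j ∈ C
  odd : ∀ i j : Fin L, (j : ℕ) = i + 1 → Odd (i : ℕ) → w i - w j ∈ D
  first : ∀ i : Fin L, (i : ℕ) = 0 → w i ∈ D

/-- From `w` to its image, each condition is a sum or difference of old ones. The converse avoids
the inverse matrix: each difference of the image combines two differences of `w`, so a known one
yields the next, in `C` upwards from the Dirichlet end and in `D` downwards from the Neumann end. -/
theorem isChain_pathMatrix_iff (hL : Even L) {H C D : Submodule ℝ M} {w : Fin L → M} :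
    IsChain H D C (matrixAct (pathMatrix L) w) ↔ IsChain H C D w := by
  have hH := matrixAct_mem_iff (w := w) (pathMatrix_isUnit hL) (H := H)
  obtain ⟨W, rfl⟩ := exists_nat_extension w
  obtain ⟨m, rfl⟩ := hL
  have X0 : ∀ (h : 0 < m + m), matrixAct (pathMatrix (m + m)) (fun j => W j) ⟨0, h⟩ =
      W 1 - W 0 := fun h => by
    rw [matrixAct_pathMatrix]
    simp only [zero_add, if_pos (show 1 < m + m by omega), if_true]
    simp [sub_eq_add_neg]
  have X1 : ∀ i (h : i + 1 < m + m), i + 2 < m + m →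
      matrixAct (pathMatrix (m + m)) (fun j => W j) ⟨i + 1, h⟩ = W (i + 2) + W i :=
    fun i h h' => by
      rw [matrixAct_pathMatrix]
      simp [show i + 1 + 1 < m + m from h']
  have X2 : ∀ i (h : i + 1 < m + m), ¬ i + 2 < m + m →
      matrixAct (pathMatrix (m + m)) (fun j => W j) ⟨i + 1, h⟩ = W (i + 1) + W i :=
    fun i h h' => by
      rw [matrixAct_pathMatrix]
      simp [show ¬ i + 1 + 1 < m + m from h']
  constructor
  · rintro ⟨g1, g2, g3, g4⟩
    -- The seed is the first entry of the image, `W 1 - W 0`.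
    have c : ∀ k, 2 * k + 1 < m + m → W (2 * k) - W (2 * k + 1) ∈ C := by
      intro k
      induction k with
      | zero =>
        intro hk
        have := g4 ⟨0, by omega⟩ rfl
        rw [X0] at this
        simpa using C.neg_mem this
      | succ k ih =>
        intro hk
        have e := ih (by omega)
        have e1 := g3 ⟨2 * k + 1, by omega⟩ ⟨2 * k + 1 + 1, by omega⟩ rfl ⟨k, rfl⟩
        rw [X1 _ _ (by omega), X1 _ _ (by omega)] at e1
        have := C.sub_mem e1 e
        rw [show 2 * (k + 1) + 1 = 2 * k + 1 + 2 by ring, show 2 * (k + 1) = 2 * k + 2 by ring]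
        convert this using 1
        abel
    -- The seed is the last difference of the image: the two terms `W (L - 1)` cancel there, leaving
    -- a single difference of `W`.
    have d : ∀ k, k + 1 < m → W (2 * (m - 2 - k) + 1) - W (2 * (m - 2 - k) + 2) ∈ D := by
      intro k
      induction k with
      | zero =>
        intro hk
        obtain ⟨t, rfl⟩ : ∃ t, m = t + 2 := ⟨m - 2, by omega⟩
        have e1 := g2 ⟨2 * t + 1 + 1, by omega⟩ ⟨2 * t + 2 + 1, by omega⟩ rfl ⟨t + 1, by ring⟩
        rw [X1 _ _ (by omega), X2 _ _ (by omega)] at e1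
        convert e1 using 1
        simp
      | succ k ih =>
        intro hk
        have e := ih (by omega)
        obtain ⟨t, ht⟩ : ∃ t, m - 2 - (k + 1) = t := ⟨_, rfl⟩
        rw [show m - 2 - k = t + 1 by omega] at e
        rw [ht]
        have e1 := g2 ⟨2 * t + 1 + 1, by omega⟩ ⟨2 * t + 2 + 1, by omega⟩ rfl ⟨t + 1, by ring⟩
        rw [X1 _ _ (by omega), X1 _ _ (by omega)] at e1
        have := D.sub_mem e1 e
        convert this using 1
        rw [show 2 * (t + 1) + 1 = 2 * t + 1 + 2 by ring,
          show 2 * (t + 1) + 2 = 2 * t + 2 + 2 by ring]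
        abel
    refine ⟨hH.1 g1, ?_, ?_, ?_⟩
    · rintro ⟨i, hi⟩ ⟨j, hj⟩ hij hi'
      obtain ⟨k, rfl⟩ := even_iff_exists_two_mul.1 hi'
      simp only at hij
      subst hij
      exact c k hj
    · rintro ⟨i, hi⟩ ⟨j, hj⟩ hij ⟨k, hk⟩
      simp only at hij hk
      subst hij hk
      have := d (m - 2 - k) (by omega)
      rwa [show m - 2 - (m - 2 - k) = k by omega] at this
    · rintro ⟨i, hi⟩ hi0
      simp only at hi0
      subst hi0
      have e := g2 ⟨0, by omega⟩ ⟨0 + 1, by omega⟩ rfl ⟨0, rfl⟩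
      rw [X0] at e
      -- The sign at the Dirichlet end puts `-2 • W 0` into the first difference of the image. With
      -- only two copies (`m = 1`) nothing else remains there.
      have e' : (2 : ℝ) • W 0 ∈ D := by
        by_cases hm : m = 1
        · rw [X2 _ _ (by omega)] at e
          convert D.neg_mem e using 1
          rw [two_smul]
          simp
        · rw [X1 _ _ (by omega)] at e
          have e2 := d (m - 2) (by omega)
          convert D.sub_mem e2 e using 1
          rw [two_smul]
          simp
          abel
      exact (D.smul_mem_iff two_ne_zero).1 e'
  · rintro ⟨g1, g2, g3, g4⟩
    refine ⟨hH.2 g1, ?_, ?_, ?_⟩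
    · rintro ⟨i, hi⟩ ⟨j, hj⟩ hij hi'
      simp only at hij
      subst hij
      rcases i with _ | i
      · have e0 := g4 ⟨0, hi⟩ rfl
        rw [X0]
        by_cases hm : m = 1
        · rw [X2 _ _ (by omega)]
          convert D.neg_mem (D.add_mem e0 e0) using 1
          simp
          abel
        · rw [X1 _ _ (by omega)]
          have e1 := g3 ⟨1, by omega⟩ ⟨2, by omega⟩ rfl ⟨0, rfl⟩
          convert D.sub_mem e1 (D.add_mem e0 e0) using 1
          simp
          abel
      · have hi'' : Odd i := by
          rcases Nat.even_or_odd i with h | h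
          · exact absurd hi' (by simpa [Nat.even_add_one] using h)
          · exact h
        have e0 := g3 ⟨i, by omega⟩ ⟨i + 1, by omega⟩ rfl hi''
        rw [X1 _ _ (by omega)]
        by_cases hm : i + 1 + 2 < m + m
        · rw [X1 _ _ (by omega)]
          have e1 := g3 ⟨i + 2, by omega⟩ ⟨i + 3, by omega⟩ rfl (by
            rw [Nat.odd_iff] at hi'' ⊢
            simp only
            omega)
          convert D.add_mem e0 e1 using 1
          simp
          abel
        · rw [X2 _ _ (by omega)]
          convert e0 using 1
          simp
    · rintro ⟨i, hi⟩ ⟨j, hj⟩ hij ⟨k, hk⟩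
      simp only at hij hk
      subst hij hk
      rw [X1 _ _ (by omega), X1 _ _ (by omega)]
      have e0 := g2 ⟨2 * k, by omega⟩ ⟨2 * k + 1, by omega⟩ rfl ⟨k, by simp; ring⟩
      have e1 := g2 ⟨2 * k + 2, by omega⟩ ⟨2 * k + 3, by omega⟩ rfl ⟨k + 1, by simp; ring⟩
      convert C.add_mem e0 e1 using 1
      simp
      abel
    · rintro ⟨i, hi⟩ hi0
      simp only at hi0
      subst hi0
      rw [X0]
      convert C.neg_mem (g2 ⟨0, hi⟩ ⟨1, by omega⟩ rfl ⟨0, rfl⟩) using 1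
      simp

end Chain

/-! ### Transplantation -/

section Transplantation

variable {K : Opens Plane} {L : ℕ} {A : Matrix (Fin L) (Fin L) ℝ}
  {V V' : Submodule ℝ (Fin L → SheetField K)}

theorem matrixAct_fst (w : Fin L → SheetField K) :
    (fun j => (matrixAct A w j).1) = matrixAct A fun j => (w j).1 := by
  ext1 i
  simp only [matrixAct_apply, Prod.fst_sum, Prod.smul_fst]

theorem matrixAct_snd (w : Fin L → SheetField K) (i : Fin L) :
    (matrixAct A w i).2 = matrixAct A (fun j => (w j).2) i := by
  simp only [matrixAct_apply, Prod.snd_sum, Prod.smul_snd]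

theorem energy_matrixAct (hA : A.IsSymm) (u v : Fin L → SheetField K) :
    energy (matrixAct A u) v = energy u (matrixAct A v) := by
  simp only [energy, matrixAct_snd]
  exact sum_inner_matrixAct hA _ _

theorem mass_matrixAct (hA : A.IsSymm)
    (f g : Fin L → Lp ℝ 2 (volume.restrict (K : Set Plane))) :
    mass (matrixAct A f) g = mass f (matrixAct A g) :=
  sum_inner_matrixAct hA _ _

/-- A symmetric invertible matrix which exchanges two form domains transplants weak solutions. -/
theorem isWeakSolution_matrixAct_iff (hA : A.IsSymm) (hu : IsUnit A)
    (h : ∀ w, matrixAct A w ∈ V' ↔ w ∈ V) (h' : ∀ w, matrixAct A w ∈ V ↔ w ∈ V') (l : ℝ)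
    (f : Fin L → Lp ℝ 2 (volume.restrict (K : Set Plane))) (u : Fin L → SheetField K) :
    IsWeakSolution V' l (matrixAct A f) (matrixAct A u) ↔ IsWeakSolution V l f u := by
  -- Symmetry moves `A` onto the test function. Orthogonality is not required, because `A v` runs
  -- through all of `V` as `v` runs through `V'`.
  have e : ∀ v, (energy (matrixAct A u) v - l * mass (fun j => (matrixAct A u j).1)
      (fun j => (v j).1) = mass (matrixAct A f) (fun j => (v j).1)) ↔
      (energy u (matrixAct A v) - l * mass (fun j => (u j).1)
      (fun j => (matrixAct A v j).1) = mass f (fun j => (matrixAct A v j).1)) := fun v => by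
    simp only [matrixAct_fst, energy_matrixAct hA, mass_matrixAct hA]
  refine and_congr (h u) ⟨fun H v hv => ?_, fun H v hv => ?_⟩
  · obtain ⟨v, rfl⟩ := (matrixActEquiv hu).surjective v
    exact (e v).1 (H v ((h' v).1 hv))
  · exact (e v).2 (H _ ((h' v).2 hv))

theorem laplaceSpectrum_eq_of_matrixAct (hA : A.IsSymm) (hu : IsUnit A)
    (h : ∀ w, matrixAct A w ∈ V' ↔ w ∈ V) (h' : ∀ w, matrixAct A w ∈ V ↔ w ∈ V') :
    laplaceSpectrum V = laplaceSpectrum V' := by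
  ext l
  refine not_congr (Iff.trans (forall_congr' fun f => ?_) (matrixActEquiv hu).surjective.forall.symm)
  refine Iff.trans ?_ (matrixActEquiv hu).bijective.existsUnique_iff.symm
  simp only [matrixActEquiv_apply, isWeakSolution_matrixAct_iff hA hu h h']

theorem multiplicity_eq_of_matrixAct (hA : A.IsSymm) (hu : IsUnit A)
    (h : ∀ w, matrixAct A w ∈ V' ↔ w ∈ V) (h' : ∀ w, matrixAct A w ∈ V ↔ w ∈ V') (l : ℝ) :
    multiplicity V l = multiplicity V' l := by
  have e : (eigenspace V l).map (matrixActEquiv hu).toLinearMap = eigenspace V' l := by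
    ext u
    obtain ⟨u, rfl⟩ := (matrixActEquiv hu).surjective u
    have := isWeakSolution_matrixAct_iff hA hu h h' l 0 u
    rw [map_zero] at this
    rw [Submodule.mem_map]
    constructor
    · rintro ⟨w, hw, hwu⟩
      obtain rfl := (matrixActEquiv hu).injective hwu
      exact this.2 hw
    · exact fun hw => ⟨u, this.1 hw, rfl⟩
  unfold multiplicity
  rw [← e]
  exact ((matrixActEquiv hu).submoduleMap (eigenspace V l)).rank_eq

end Transplantation

/-! ### Closedness of the Sobolev space -/

theorem memLp_fderiv_apply {φ : Plane → ℝ} (h1 : ContDiff ℝ ∞ φ) (h2 : HasCompactSupport φ)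
    (v : Plane) (μ : Measure Plane) [IsFiniteMeasureOnCompacts μ] :
    MemLp (fun x => fderiv ℝ φ x v) 2 μ :=
  ((h1.continuous_fderiv (by simp)).clm_apply continuous_const).memLp_of_hasCompactSupport
    (h2.fderiv_apply (𝕜 := ℝ) v)

theorem memLp_smul_const {φ : Plane → ℝ} (h1 : ContDiff ℝ ∞ φ) (h2 : HasCompactSupport φ)
    (v : Plane) (μ : Measure Plane) [IsFiniteMeasureOnCompacts μ] :
    MemLp (fun x => φ x • v) 2 μ :=
  (h1.continuous.smul continuous_const).memLp_of_hasCompactSupport h2.smul_right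

/-- For a fixed test function and direction, the weak gradient identity equates two continuous
functionals of the pair. Closedness is needed because the Dirichlet condition is defined by a
closure, whose elements must be `H¹` to be reflected evenly. -/
theorem isClosed_sobolevSpace (K : Opens Plane) :
    IsClosed (sobolevSpace K : Set (SheetField K)) := by
  have e : (sobolevSpace K : Set (SheetField K)) =
      ⋂ (φ : Plane → ℝ) (h1 : ContDiff ℝ ∞ φ) (h2 : HasCompactSupport φ)
        (_ : tsupport φ ⊆ (K : Set Plane)) (v : Plane), {p : SheetField K |
          inner ℝ p.1 ((memLp_fderiv_apply h1 h2 v _).toLp _) =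
            - inner ℝ p.2 ((memLp_smul_const h1 h2 v _).toLp _)} := by
    ext p
    have key : ∀ (φ : Plane → ℝ) (h1 : ContDiff ℝ ∞ φ) (h2 : HasCompactSupport φ) (v : Plane),
        (inner ℝ p.1 ((memLp_fderiv_apply h1 h2 v _).toLp _) =
            - inner ℝ p.2 ((memLp_smul_const h1 h2 v _).toLp _)) ↔
        ∫ x in (K : Set Plane), p.1 x * fderiv ℝ φ x v =
          - ∫ x in (K : Set Plane), inner ℝ (p.2 x) v * φ x := by
      intro φ h1 h2 v
      rw [L2.inner_def, L2.inner_def]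
      have e1 : ∫ x in (K : Set Plane), inner ℝ (p.1 x)
          ((memLp_fderiv_apply h1 h2 v (volume.restrict (K : Set Plane))).toLp _ x) =
          ∫ x in (K : Set Plane), p.1 x * fderiv ℝ φ x v := by
        refine integral_congr_ae ?_
        filter_upwards [(memLp_fderiv_apply h1 h2 v
          (volume.restrict (K : Set Plane))).coeFn_toLp] with x hx
        rw [hx, real_inner_eq_re_inner]
        simp [mul_comm]
      have e2 : ∫ x in (K : Set Plane), inner ℝ (p.2 x)
          ((memLp_smul_const h1 h2 v (volume.restrict (K : Set Plane))).toLp _ x) =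
          ∫ x in (K : Set Plane), inner ℝ (p.2 x) v * φ x := by
        refine integral_congr_ae ?_
        filter_upwards [(memLp_smul_const h1 h2 v
          (volume.restrict (K : Set Plane))).coeFn_toLp] with x hx
        rw [hx, real_inner_smul_right, mul_comm]
      rw [e1, e2]
    simp only [Set.mem_iInter]
    exact ⟨fun h φ h1 h2 h3 v => (key φ h1 h2 v).2 (h.2.2 φ h1 h2 h3 v),
      fun h => ⟨Lp.memLp _, Lp.memLp _, fun φ h1 h2 h3 v => (key φ h1 h2 v).1 (h φ h1 h2 h3 v)⟩⟩
  rw [e]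
  refine isClosed_iInter fun φ => isClosed_iInter fun h1 => isClosed_iInter fun h2 =>
    isClosed_iInter fun h3 => isClosed_iInter fun v => isClosed_eq ?_ ?_
  · exact continuous_fst.inner continuous_const
  · exact (continuous_snd.inner continuous_const).neg

theorem sobolevVanishing_le (K : Opens Plane) (Γ : Set Plane) :
    sobolevVanishing K Γ ≤ sobolevSpace K :=
  Submodule.topologicalClosure_minimal _ (fun _ hp => hp.1) (isClosed_sobolevSpace K)

/-! ### Integration by parts up to a line -/

theorem exists_abs_deriv_smoothTransition_le :
    ∃ B : ℝ, ∀ t, |deriv Real.smoothTransition t| ≤ B ∧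
      (1 < t → deriv Real.smoothTransition t = 0) := by
  have h1 : ∀ t : ℝ, 1 < t → deriv Real.smoothTransition t = 0 := fun t ht => by
    have : Real.smoothTransition =ᶠ[nhds t] fun _ => 1 := by
      filter_upwards [Ioi_mem_nhds ht] with s hs
      exact Real.smoothTransition.one_of_one_le (le_of_lt hs)
    rw [this.deriv_eq, deriv_const]
  have h0 : ∀ t : ℝ, t < 0 → deriv Real.smoothTransition t = 0 := fun t ht => by
    have : Real.smoothTransition =ᶠ[nhds t] fun _ => 0 := by
      filter_upwards [Iio_mem_nhds ht] with s hs
      exact Real.smoothTransition.zero_of_nonpos (le_of_lt hs)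
    rw [this.deriv_eq, deriv_const]
  have hc : Continuous (deriv Real.smoothTransition) :=
    (Real.smoothTransition.contDiff (n := 1)).continuous_deriv (by simp)
  obtain ⟨B, hB⟩ := (isCompact_Icc (a := (0 : ℝ)) (b := 1)).exists_bound_of_continuousOn
    hc.continuousOn
  have hB0 : 0 ≤ B := (norm_nonneg _).trans (hB 0 (by simp))
  refine ⟨B, fun t => ⟨?_, h1 t⟩⟩
  by_cases ht : t ∈ Set.Icc (0 : ℝ) 1
  · exact hB t ht
  · rcases lt_or_ge t 0 with h | h
    · simpa [h0 t h] using hB0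
    · have : 1 < t := by
        by_contra h'
        exact ht ⟨h, not_lt.1 h'⟩
      simpa [h1 t this] using hB0

/-- Integration by parts in a domain on one side of a line, against a function that is compactly
supported up to the line and for which the normal component of `ψ v` vanishes on the line. -/
theorem IsSobolevPair.integral_mul_fderiv {K : Opens Plane} {u : Plane → ℝ} {F : Plane → Plane}
    (h : IsSobolevPair K u F) (hb : Bornology.IsBounded (K : Set Plane)) {n p₀ : Plane}
    (hn : ∀ x ∈ K, 0 < inner ℝ n (x - p₀)) {ψ : Plane → ℝ} (h1 : ContDiff ℝ ∞ ψ)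
    (h2 : HasCompactSupport ψ) (h3 : ∀ x ∈ tsupport ψ, 0 < inner ℝ n (x - p₀) → x ∈ K)
    {v : Plane} {C : ℝ} (hC : ∀ x ∈ K, |inner ℝ n v * ψ x| ≤ C * inner ℝ n (x - p₀)) :
    ∫ x in (K : Set Plane), u x * fderiv ℝ ψ x v =
      - ∫ x in (K : Set Plane), inner ℝ (F x) v * ψ x := by
  obtain ⟨B, hB⟩ := exists_abs_deriv_smoothTransition_le
  set s : Plane → ℝ := fun x => inner ℝ n (x - p₀) with hs
  have hB0 : 0 ≤ B := (abs_nonneg _).trans (hB 0).1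
  have hsd : ContDiff ℝ ∞ s := contDiff_const.inner ℝ (contDiff_id.sub contDiff_const)
  have hsc : Continuous s := hsd.continuous
  have hs' : ∀ x, HasFDerivAt s (innerSL ℝ n) x := fun x => by
    have := ((innerSL ℝ n).hasFDerivAt (x := x - p₀)).comp x ((hasFDerivAt_id x).sub_const p₀)
    rw [ContinuousLinearMap.comp_id] at this
    exact this
  -- For `k ≥ 1` the cutoff is `0` where `s ≤ 1 / k` and `1` where `s ≥ 2 / k`, so `η k * ψ` is an
  -- admissible test function in `K`.
  let η : ℕ → Plane → ℝ := fun k x => Real.smoothTransition ((k : ℝ) * s x - 1)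
  have hη : ∀ k, ContDiff ℝ ∞ (η k) := fun k =>
    (Real.smoothTransition.contDiff (n := ⊤)).comp ((contDiff_const.mul hsd).sub contDiff_const)
  have hη' : ∀ k x, HasFDerivAt (η k)
      ((deriv Real.smoothTransition ((k : ℝ) * s x - 1)) • ((k : ℝ) • innerSL ℝ n)) x :=
    fun k x => by
      have d : HasDerivAt Real.smoothTransition
          (deriv Real.smoothTransition ((k : ℝ) * s x - 1)) ((k : ℝ) * s x - 1) :=
        ((Real.smoothTransition.contDiff (n := 1)).differentiable (by simp) _).hasDerivAt
      exact d.comp_hasFDerivAt x (((hs' x).const_mul (k : ℝ)).sub_const 1)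
  have hη01 : ∀ k x, |η k x| ≤ 1 := fun k x => by
    rw [abs_of_nonneg (Real.smoothTransition.nonneg _)]
    exact Real.smoothTransition.le_one _
  have hprod : ∀ k x, fderiv ℝ (fun x => η k x * ψ x) x v = η k x * fderiv ℝ ψ x v +
      ψ x * (deriv Real.smoothTransition ((k : ℝ) * s x - 1) * (k * inner ℝ n v)) := fun k x => by
    have := ((hη' k x).mul (h1.differentiable (by simp) x).hasFDerivAt).fderiv
    rw [show (fun x => η k x * ψ x) = η k * ψ from rfl, this]
    simp
  have hlim : ∀ x ∈ K, ∀ᶠ k : ℕ in Filter.atTop, 1 < (k : ℝ) * s x - 1 := fun x hx => by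
    have : Filter.Tendsto (fun k : ℕ => (k : ℝ) * s x) Filter.atTop Filter.atTop :=
      tendsto_natCast_atTop_atTop.atTop_mul_const (hn x hx)
    filter_upwards [this.eventually_gt_atTop 2] with k hk
    linarith
  have hid : ∀ k : ℕ, ∫ x in (K : Set Plane), u x * (η k x * fderiv ℝ ψ x v +
      ψ x * (deriv Real.smoothTransition ((k : ℝ) * s x - 1) * (k * inner ℝ n v))) =
      - ∫ x in (K : Set Plane), inner ℝ (F x) v * (η k x * ψ x) := fun k => by
    have := h.2.2 (fun x => η k x * ψ x) ((hη k).mul h1) h2.mul_left ?_ v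
    · simpa only [hprod] using this
    · intro x hx
      refine h3 x (tsupport_mul_subset_right hx) ?_
      have hcl : IsClosed {x | 1 ≤ (k : ℝ) * s x} :=
        isClosed_le continuous_const (continuous_const.mul hsc)
      have hsub : tsupport (fun x => η k x * ψ x) ⊆ {x | 1 ≤ (k : ℝ) * s x} := by
        refine closure_minimal (fun y hy => ?_) hcl
        by_contra hlt
        refine hy ?_
        have : η k y = 0 := Real.smoothTransition.zero_of_nonpos (by
          simp only [Set.mem_ofPred_eq, not_le] at hlt
          linarith)
        simp [this]
      have h4 : 1 ≤ (k : ℝ) * s x := hsub hx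
      by_contra h5
      have := mul_nonpos_of_nonneg_of_nonpos (Nat.cast_nonneg (α := ℝ) k) (not_lt.1 h5)
      linarith
  -- Boundedness of `K` makes `u` integrable, as the dominating function `2 * |C| * B * |u|` below
  -- requires.
  have : IsFiniteMeasure (volume.restrict (K : Set Plane)) :=
    ⟨by rw [Measure.restrict_apply_univ]; exact hb.measure_lt_top⟩
  have hψ : MemLp ψ 2 (volume.restrict (K : Set Plane)) :=
    h1.continuous.memLp_of_hasCompactSupport h2
  have hdψ := memLp_fderiv_apply h1 h2 v (volume.restrict (K : Set Plane))
  have hui : Integrable u (volume.restrict (K : Set Plane)) := h.1.integrable (by norm_num)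
  have hFi : Integrable (fun x => inner ℝ (F x) v * ψ x) (volume.restrict (K : Set Plane)) :=
    (h.2.1.inner_const v).integrable_mul hψ
  have hθ : Continuous (deriv Real.smoothTransition) :=
    (Real.smoothTransition.contDiff (n := 1)).continuous_deriv (by simp)
  have hdc : Continuous fun x => fderiv ℝ ψ x v :=
    (h1.continuous_fderiv (by simp)).clm_apply continuous_const
  -- The derivative of the cutoff has size `k`, but in `K` it lives where `s ≤ 2 / k`, and there the
  -- normal component of `ψ v` is at most `C * s`. The product is bounded uniformly in `k`.
  have hbd : ∀ k : ℕ, ∀ x ∈ K,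
      |ψ x * (deriv Real.smoothTransition ((k : ℝ) * s x - 1) * (k * inner ℝ n v))| ≤
        2 * |C| * B := fun k x hx => by
    by_cases ht : 1 < (k : ℝ) * s x - 1
    · rw [(hB _).2 ht]
      simp only [zero_mul, mul_zero, abs_zero]
      positivity
    · have e : ψ x * (deriv Real.smoothTransition ((k : ℝ) * s x - 1) * (k * inner ℝ n v)) =
          (k * (inner ℝ n v * ψ x)) * deriv Real.smoothTransition ((k : ℝ) * s x - 1) := by ring
      rw [e, abs_mul, abs_mul, Nat.abs_cast]
      have g1 : (k : ℝ) * |inner ℝ n v * ψ x| ≤ 2 * |C| := by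
        have hsx : 0 < s x := hn x hx
        calc (k : ℝ) * |inner ℝ n v * ψ x| ≤ k * (C * s x) :=
              mul_le_mul_of_nonneg_left (hC x hx) (Nat.cast_nonneg k)
          _ = C * (k * s x) := by ring
          _ ≤ |C| * (k * s x) := mul_le_mul_of_nonneg_right (le_abs_self C) (by positivity)
          _ ≤ |C| * 2 := mul_le_mul_of_nonneg_left (by linarith) (abs_nonneg C)
          _ = 2 * |C| := mul_comm _ _
      exact mul_le_mul g1 (hB _).1 (abs_nonneg _) (by positivity)
  have lim1 : Filter.Tendsto (fun k : ℕ => ∫ x in (K : Set Plane), u x * (η k x * fderiv ℝ ψ x v +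
      ψ x * (deriv Real.smoothTransition ((k : ℝ) * s x - 1) * (k * inner ℝ n v))))
      Filter.atTop (nhds (∫ x in (K : Set Plane), u x * fderiv ℝ ψ x v)) := by
    refine tendsto_integral_of_dominated_convergence
      (fun x => |u x * fderiv ℝ ψ x v| + 2 * |C| * B * |u x|) (fun k => ?_) ?_ (fun k => ?_) ?_
    · refine h.1.1.mul (Continuous.aestronglyMeasurable ?_)
      have := (hη k).continuous
      have := h1.continuous
      fun_prop
    · exact (h.1.integrable_mul hdψ).abs.add (hui.abs.const_mul _)
    · filter_upwards [ae_restrict_mem K.isOpen.measurableSet] with x hx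
      rw [mul_add]
      refine (norm_add_le _ _).trans (add_le_add ?_ ?_)
      · rw [Real.norm_eq_abs, mul_left_comm, abs_mul]
        exact mul_le_of_le_one_left (abs_nonneg _) (hη01 k x)
      · rw [Real.norm_eq_abs, abs_mul, mul_comm]
        exact mul_le_mul_of_nonneg_right (hbd k x hx) (abs_nonneg _)
    · filter_upwards [ae_restrict_mem K.isOpen.measurableSet] with x hx
      refine tendsto_const_nhds.congr' ?_
      filter_upwards [hlim x hx] with k hk
      have : η k x = 1 := Real.smoothTransition.one_of_one_le hk.le
      rw [(hB _).2 hk, this]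
      simp
  have lim2 : Filter.Tendsto (fun k : ℕ => ∫ x in (K : Set Plane), inner ℝ (F x) v * (η k x * ψ x))
      Filter.atTop (nhds (∫ x in (K : Set Plane), inner ℝ (F x) v * ψ x)) := by
    refine tendsto_integral_of_dominated_convergence
      (fun x => |inner ℝ (F x) v * ψ x|) (fun k => ?_) hFi.abs (fun k => ?_) ?_
    · exact (h.2.1.inner_const v).1.mul
        ((hη k).continuous.mul h1.continuous).aestronglyMeasurable
    · refine Filter.Eventually.of_forall fun x => ?_
      rw [Real.norm_eq_abs, mul_left_comm, abs_mul]
      exact mul_le_of_le_one_left (abs_nonneg _) (hη01 k x)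
    · filter_upwards [ae_restrict_mem K.isOpen.measurableSet] with x hx
      refine tendsto_const_nhds.congr' ?_
      filter_upwards [hlim x hx] with k hk
      have : η k x = 1 := Real.smoothTransition.one_of_one_le hk.le
      rw [this, one_mul]
  simp only [hid] at lim1
  exact tendsto_nhds_unique lim1 lim2.neg

/-! ### Reflections in lines of the plane -/

/-- The orthogonal complement of the direction is spanned by one vector, and reflection in the
direction is minus reflection in that span. -/
theorem exists_unit_normal (c : AffineSubspace ℝ Plane) [Nonempty c]
    (hc : Module.finrank ℝ c.direction = 1) :
    ∃ n p₀ : Plane, ‖n‖ = 1 ∧ (∀ x, x ∈ c ↔ inner ℝ n (x - p₀) = 0) ∧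
      (∀ v, c.direction.reflection v = v - (2 * inner ℝ n v) • n) ∧
      ∀ x, refl c x = x - (2 * inner ℝ n (x - p₀)) • n := by
  obtain ⟨p₀, hp₀⟩ := (inferInstance : Nonempty c)
  have hf := c.direction.finrank_add_finrank_orthogonal
  rw [hc, finrank_euclideanSpace_fin] at hf
  obtain ⟨⟨m, hm⟩, hm0, hspan⟩ := finrank_eq_one_iff'.1
    (show Module.finrank ℝ c.directionᗮ = 1 by omega)
  have hm0' : m ≠ 0 := fun h => hm0 (Subtype.ext h)
  have hdir : c.directionᗮ = Submodule.span ℝ {m} := by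
    refine le_antisymm (fun w hw => ?_) ((Submodule.span_singleton_le_iff_mem _ _).2 hm)
    obtain ⟨r, hr⟩ := hspan ⟨w, hw⟩
    exact Submodule.mem_span_singleton.2 ⟨r, congrArg Subtype.val hr⟩
  have hmem : ∀ v, v ∈ c.direction ↔ inner ℝ m v = 0 := fun v => by
    rw [← c.direction.orthogonal_orthogonal, hdir, Submodule.mem_orthogonal_singleton_iff_inner_right]
  have hrefl : ∀ v, c.direction.reflection v = v - (2 * (inner ℝ m v / ‖m‖ ^ 2)) • m := fun v => by
    have h1 := c.direction.reflection_orthogonal_apply v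
    have h2 : c.directionᗮ.reflection v = (Submodule.span ℝ {m}).reflection v := by
      simp only [hdir]
    rw [Submodule.reflection_singleton_apply] at h2
    rw [← neg_inj, ← h1, h2, two_smul, mul_smul, two_smul]
    simp
  have hmn : ‖m‖ ≠ 0 := norm_ne_zero_iff.2 hm0'
  have hrefl' : ∀ v, c.direction.reflection v =
      v - (2 * inner ℝ (‖m‖⁻¹ • m) v) • (‖m‖⁻¹ • m) := fun v => by
    rw [hrefl, real_inner_smul_left, smul_smul]
    congr 2
    field_simp
  refine ⟨‖m‖⁻¹ • m, p₀, ?_, fun x => ?_, hrefl', fun x => ?_⟩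
  · rw [norm_smul, norm_inv, norm_norm, inv_mul_cancel₀ hmn]
  · rw [real_inner_smul_left, mul_eq_zero, or_iff_right (inv_ne_zero hmn), ← hmem]
    exact (AffineSubspace.vsub_right_mem_direction_iff_mem hp₀ x).symm
  · rw [refl, EuclideanGeometry.reflection_apply_of_mem c x hp₀, vsub_eq_sub, hrefl', vadd_eq_add]
    abel

theorem inner_mul_inner_pos_of_sSameSide {c : AffineSubspace ℝ Plane} {n p₀ : Plane}
    (hmem : ∀ x, x ∈ c ↔ inner ℝ n (x - p₀) = 0) {x y : Plane} (h : c.SSameSide x y) :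
    0 < inner ℝ n (x - p₀) * inner ℝ n (y - p₀) := by
  obtain ⟨⟨p, hp, q, hq, hr⟩, hx, hy⟩ := h
  have h1 := hr.map (innerSL ℝ n).toLinearMap
  have e1 : inner ℝ n (x - p) = inner ℝ n (x - p₀) := by
    rw [← sub_zero (inner ℝ n (x - p₀)), ← (hmem p).1 hp, ← inner_sub_right]
    congr 1
    abel
  have e2 : inner ℝ n (y - q) = inner ℝ n (y - p₀) := by
    rw [← sub_zero (inner ℝ n (y - p₀)), ← (hmem q).1 hq, ← inner_sub_right]
    congr 1
    abel
  have h2 : SameRay ℝ (inner ℝ n (x - p₀)) (inner ℝ n (y - p₀)) := by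
    rw [← e1, ← e2]
    exact h1
  have hx' : inner ℝ n (x - p₀) ≠ 0 := fun h => hx ((hmem x).2 h)
  have hy' : inner ℝ n (y - p₀) ≠ 0 := fun h => hy ((hmem y).2 h)
  obtain ⟨r, hr0, hr'⟩ := h2.exists_pos_left hx' hy'
  rw [← hr', smul_eq_mul]
  have := mul_self_pos.2 hx'
  nlinarith [mul_pos hr0 this]

/-- A domain strictly on one side of a line lies in the open half plane given by a suitable unit
normal of the line. -/
theorem exists_unit_normal_pos (c : AffineSubspace ℝ Plane) [Nonempty c]
    (hc : Module.finrank ℝ c.direction = 1) {K : Set Plane}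
    (hK : ∀ x ∈ K, ∀ y ∈ K, c.SSameSide x y) :
    ∃ n p₀ : Plane, ‖n‖ = 1 ∧ (∀ x, x ∈ c ↔ inner ℝ n (x - p₀) = 0) ∧
      (∀ v, c.direction.reflection v = v - (2 * inner ℝ n v) • n) ∧
      (∀ x, refl c x = x - (2 * inner ℝ n (x - p₀)) • n) ∧ ∀ x ∈ K, 0 < inner ℝ n (x - p₀) := by
  obtain ⟨n, p₀, h1, h2, h3, h4⟩ := exists_unit_normal c hc
  by_cases hpos : ∀ x ∈ K, 0 < inner ℝ n (x - p₀)
  · exact ⟨n, p₀, h1, h2, h3, h4, hpos⟩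
  · push Not at hpos
    obtain ⟨y, hy, hy'⟩ := hpos
    -- One point with nonpositive coordinate forces all coordinates to be negative, since their
    -- products are positive.
    refine ⟨-n, p₀, by rw [norm_neg, h1], fun x => by rw [h2, inner_neg_left, neg_eq_zero],
      fun v => by rw [h3]; simp, fun x => by rw [h4]; simp, fun x hx => ?_⟩
    have := inner_mul_inner_pos_of_sSameSide h2 (hK x hx y hy)
    rw [inner_neg_left]
    by_contra h
    have := mul_nonpos_of_nonneg_of_nonpos (show 0 ≤ inner ℝ n (x - p₀) by linarith) hy'
    linarith

theorem refl_refl (c : AffineSubspace ℝ Plane) [Nonempty c] (x : Plane) :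
    refl c (refl c x) = x :=
  EuclideanGeometry.reflection_reflection c x

/-! ### Even reflection -/

theorem measurableEmbedding_refl (c : AffineSubspace ℝ Plane) [Nonempty c] :
    MeasurableEmbedding (refl c) :=
  (EuclideanGeometry.reflection c).toHomeomorph.measurableEmbedding

theorem contDiff_refl (c : AffineSubspace ℝ Plane) [Nonempty c] {m : WithTop ℕ∞} :
    ContDiff ℝ m (refl c) :=
  ((c.direction.reflection : Plane →L[ℝ] Plane).contDiff.comp
    (contDiff_id.sub (contDiff_const (c := ((Classical.arbitrary c : c) : Plane))))).add
      contDiff_const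

theorem hasFDerivAt_refl (c : AffineSubspace ℝ Plane) [Nonempty c] (x : Plane) :
    HasFDerivAt (refl c) (c.direction.reflection : Plane →L[ℝ] Plane) x := by
  have h := ((c.direction.reflection : Plane →L[ℝ] Plane).hasFDerivAt
    (x := x - (Classical.arbitrary c : c))).comp x
      ((hasFDerivAt_id x).sub_const ((Classical.arbitrary c : c) : Plane))
  rw [ContinuousLinearMap.comp_id] at h
  exact h.add_const ((Classical.arbitrary c : c) : Plane)

theorem fderiv_comp_refl (c : AffineSubspace ℝ Plane) [Nonempty c] {φ : Plane → ℝ}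
    (h : Differentiable ℝ φ) (x v : Plane) :
    fderiv ℝ (fun y => φ (refl c y)) x v = fderiv ℝ φ (refl c x) (c.direction.reflection v) := by
  have := ((h (refl c x)).hasFDerivAt.comp x (hasFDerivAt_refl c x)).fderiv
  rw [show (fun y => φ (refl c y)) = φ ∘ refl c from rfl, this]
  rfl

/-- Integration over the doubled domain of a function given on the two halves, against a weight
that vanishes off the doubled domain, reduces to an integration over `K`. -/
theorem setIntegral_doubled (c : AffineSubspace ℝ Plane) [Nonempty c] (K : Opens Plane)
    {E : Type*} [Zero E] {w₁ w₂ : E → Plane → ℝ} (h₁ : ∀ x, w₁ 0 x = 0) (h₂ : ∀ x, w₂ 0 x = 0)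
    {f g : Plane → E} (hw : ∀ x ∉ doubled c K, ∀ e, w₁ e x = 0 ∧ w₂ e x = 0)
    (i₁ : IntegrableOn (fun x => w₁ (f x) x) K)
    (i₂ : IntegrableOn (fun x => w₂ (g x) (refl c x)) K) :
    ∫ x in doubled c K, (w₁ ((K : Set Plane).indicator f x) x +
        w₂ ((K : Set Plane).indicator g (refl c x)) x) =
      ∫ x in (K : Set Plane), (w₁ (f x) x + w₂ (g x) (refl c x)) := by
  have hm := K.isOpen.measurableSet
  -- Passing to the whole plane lets the two indicators be treated separately.
  rw [setIntegral_eq_integral_of_forall_compl_eq_zero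
    (fun x hx => by rw [(hw x hx _).1, (hw x hx _).2, add_zero])]
  have e₁ : (fun x => w₁ ((K : Set Plane).indicator f x) x) =
      (K : Set Plane).indicator fun x => w₁ (f x) x := by
    ext x
    by_cases hx : x ∈ (K : Set Plane) <;> simp [hx, h₁]
  have e₂ : (fun x => w₂ ((K : Set Plane).indicator g (refl c x)) x) =
      fun x => (K : Set Plane).indicator (fun y => w₂ (g y) (refl c y)) (refl c x) := by
    ext x
    by_cases hx : refl c x ∈ (K : Set Plane) <;> simp [hx, h₂, refl_refl]
  have j₁ := (integrable_indicator_iff hm).2 i₁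
  have j₂ := (integrable_indicator_iff hm).2 i₂
  have j₂' := (measurePreserving_refl c).integrable_comp_of_integrable j₂
  rw [integral_add (by rw [e₁]; exact j₁) (by rw [e₂]; exact j₂'), e₁, e₂,
    (measurePreserving_refl c).integral_comp (measurableEmbedding_refl c),
    integral_indicator hm, integral_indicator hm, integral_add i₁ i₂]

theorem memLp_glueFun {c : AffineSubspace ℝ Plane} [Nonempty c] {K : Opens Plane}
    {f g : Plane → ℝ} (hf : MemLp f 2 (volume.restrict (K : Set Plane)))
    (hg : MemLp g 2 (volume.restrict (K : Set Plane))) : MemLp (glueFun c K f g) 2 volume :=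
  ((memLp_indicator_iff_restrict K.isOpen.measurableSet).2 hf).add
    (((memLp_indicator_iff_restrict K.isOpen.measurableSet).2 hg).comp_measurePreserving
      (measurePreserving_refl c))

theorem memLp_glueGrad {c : AffineSubspace ℝ Plane} [Nonempty c] {K : Opens Plane}
    {F G : Plane → Plane} (hF : MemLp F 2 (volume.restrict (K : Set Plane)))
    (hG : MemLp G 2 (volume.restrict (K : Set Plane))) : MemLp (glueGrad c K F G) 2 volume :=
  ((memLp_indicator_iff_restrict K.isOpen.measurableSet).2 hF).add
    ((c.direction.reflection : Plane →L[ℝ] Plane).comp_memLp'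
      (((memLp_indicator_iff_restrict K.isOpen.measurableSet).2 hG).comp_measurePreserving
        (measurePreserving_refl c)))

/-- The even reflection of an `H¹` function across a line is an `H¹` function. -/
theorem IsSobolevPair.even_reflection {c : AffineSubspace ℝ Plane} [Nonempty c]
    (hc : Module.finrank ℝ c.direction = 1) {K : Opens Plane}
    (hb : Bornology.IsBounded (K : Set Plane)) (hK : ∀ x ∈ K, ∀ y ∈ K, c.SSameSide x y)
    {u : Plane → ℝ} {F : Plane → Plane} (h : IsSobolevPair K u F) :
    IsSobolevPair (doubled c K) (glueFun c K u u) (glueGrad c K F F) := by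
  refine ⟨(memLp_glueFun h.1 h.1).restrict _, (memLp_glueGrad h.2.1 h.2.1).restrict _, ?_⟩
  intro φ h1 h2 h3 v
  obtain ⟨n, p₀, hn, hmem, hS, hT, hpos⟩ := exists_unit_normal_pos c hc (K := K) hK
  have hnn : inner ℝ n n = 1 := by rw [real_inner_self_eq_norm_sq, hn, one_pow]
  have hTs : ∀ x, inner ℝ n (refl c x - p₀) = - inner ℝ n (x - p₀) := fun x => by
    rw [hT, sub_right_comm, inner_sub_right n (x - p₀), real_inner_smul_right, hnn]
    ring
  -- In the positive half plane the doubled domain is just `K`. Test functions may reach the open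
  -- edge but meet no other part of the boundary.
  have hdK : ∀ x ∈ doubled c K, 0 < inner ℝ n (x - p₀) → x ∈ K := by
    rintro x ((hx | hx) | ⟨y, hy, rfl⟩) hx'
    · exact hx
    · exact absurd ((hmem x).1 hx.1) hx'.ne'
    · rw [hTs] at hx'
      have := hpos y hy
      linarith
  have hdT : ∀ x, refl c x ∈ doubled c K → 0 < inner ℝ n (x - p₀) → x ∈ K := by
    rintro x ((hx | hx) | ⟨y, hy, hyx⟩) hx'
    · have := hpos _ hx
      rw [hTs] at this
      linarith
    · have := (hmem _).1 hx.1
      rw [hTs] at this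
      linarith
    · have : y = x := by rw [← refl_refl c y, hyx, refl_refl]
      exact this ▸ hy
  -- Folding the mirror half onto `K` pairs the even part `φ + φ'` with the tangential component of
  -- `v` and the odd part `φ - φ'` with the normal one.
  set φ' : Plane → ℝ := fun x => φ (refl c x) with hφ'
  have h1' : ContDiff ℝ ∞ φ' := h1.comp (contDiff_refl c)
  have h2' : HasCompactSupport φ' :=
    h2.comp_homeomorph (EuclideanGeometry.reflection c).toHomeomorph
  have h3' : ∀ x ∈ tsupport φ', refl c x ∈ tsupport φ := fun x hx =>
    closure_minimal (t := refl c ⁻¹' tsupport φ) (fun y hy => subset_closure hy)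
      ((isClosed_tsupport φ).preimage (contDiff_refl c (m := 0)).continuous) hx
  have hsupp : ∀ x ∈ tsupport φ ∪ tsupport φ', 0 < inner ℝ n (x - p₀) → x ∈ K := by
    rintro x (hx | hx) hx'
    · exact hdK x (h3 hx) hx'
    · exact hdT x (h3 (h3' x hx)) hx'
  set r : ℝ := inner ℝ n v with hr
  have hv : v = (v - r • n) + r • n := (sub_add_cancel _ _).symm
  have hSv : c.direction.reflection v = (v - r • n) - r • n := by
    rw [hS, two_mul, add_smul, sub_sub]
  have hSSv : c.direction.reflection (c.direction.reflection v) = v :=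
    Submodule.reflection_reflection _ _
  have hd := h1.differentiable (by simp)
  have hd' := h1'.differentiable (by simp)
  obtain ⟨B, hB⟩ := h1.lipschitzWith_of_hasCompactSupport h2 (by simp)
  have tangential := h.integral_mul_fderiv hb hpos (h1.add h1') (h2.add h2')
    (fun x hx => hsupp x (tsupport_add φ φ' hx)) (v := v - r • n) (C := 0) (fun x _ => by
      rw [inner_sub_right, real_inner_smul_right, hnn, hr]
      simp)
  -- The odd part vanishes on the line: the Lipschitz bound and `‖x - refl c x‖ = 2 * inner ℝ n (x -
  -- p₀)` give the constant.
  have normal := h.integral_mul_fderiv hb hpos (h1.sub h1') (h2.sub h2')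
    (fun x hx => hsupp x (tsupport_sub φ φ' hx)) (v := r • n) (C := |r| * (B * 2))
    (fun x hx => by
      rw [real_inner_smul_right, hnn, mul_one, abs_mul, mul_assoc]
      refine mul_le_mul_of_nonneg_left ?_ (abs_nonneg r)
      have := hB.dist_le_mul x (refl c x)
      rw [Real.dist_eq, dist_eq_norm, hT, sub_sub_cancel, norm_smul, hn, mul_one, Real.norm_eq_abs,
        abs_of_pos (mul_pos two_pos (hpos x hx)), ← mul_assoc, ← hT] at this
      exact this)
  have hder : ∀ x, fderiv ℝ φ x v + fderiv ℝ φ (refl c x) v =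
      fderiv ℝ (φ + φ') x (v - r • n) + fderiv ℝ (φ - φ') x (r • n) := fun x => by
    have e := fderiv_comp_refl c hd x (c.direction.reflection v)
    rw [hSSv, hSv] at e
    rw [← e, fderiv_add (hd x) (hd' x), fderiv_sub (hd x) (hd' x)]
    conv_lhs => rw [hv]
    simp only [map_add, map_sub, add_apply, sub_apply, hφ']
    ring
  have hgrad : ∀ x, inner ℝ (F x) v * φ x + inner ℝ (c.direction.reflection (F x)) v * φ' x =
      inner ℝ (F x) (v - r • n) * (φ + φ') x + inner ℝ (F x) (r • n) * (φ - φ') x := fun x => by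
    rw [LinearIsometryEquiv.inner_map_eq_flip, Submodule.reflection_symm, hSv]
    conv_lhs => rw [hv]
    simp only [inner_add_right, inner_sub_right, Pi.add_apply, Pi.sub_apply]
    ring
  have hz : ∀ x ∉ doubled c K, φ x = 0 ∧ fderiv ℝ φ x = 0 := fun x hx =>
    ⟨image_eq_zero_of_notMem_tsupport fun hx' => hx (h3 hx'),
      image_eq_zero_of_notMem_tsupport fun hx' => hx (h3 (tsupport_fderiv_subset ℝ hx'))⟩
  have l2 : ∀ {ψ : Plane → ℝ}, ContDiff ℝ ∞ ψ → HasCompactSupport ψ →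
      MemLp ψ 2 (volume.restrict (K : Set Plane)) := fun g1 g2 =>
    g1.continuous.memLp_of_hasCompactSupport g2
  have hdc : MemLp (fun x => fderiv ℝ φ (refl c x) v) 2 (volume.restrict (K : Set Plane)) := by
    have := memLp_fderiv_apply h1' h2' (c.direction.reflection v) (volume.restrict (K : Set Plane))
    simpa only [hφ', fderiv_comp_refl c hd, hSSv] using this
  have lhs : ∫ x in doubled c K, glueFun c K u u x * fderiv ℝ φ x v =
      ∫ x in (K : Set Plane), (u x * fderiv ℝ φ x v + u x * fderiv ℝ φ (refl c x) v) := by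
    have := setIntegral_doubled c K (E := ℝ) (w₁ := fun e x => e * fderiv ℝ φ x v)
      (w₂ := fun e x => e * fderiv ℝ φ x v) (f := u) (g := u) (fun x => zero_mul _)
      (fun x => zero_mul _) (fun x hx e => by simp [(hz x hx).2])
      (h.1.integrable_mul (memLp_fderiv_apply h1 h2 v _)) (h.1.integrable_mul hdc)
    simpa only [glueFun, add_mul] using this
  have rhs : ∫ x in doubled c K, inner ℝ (glueGrad c K F F x) v * φ x =
      ∫ x in (K : Set Plane), (inner ℝ (F x) v * φ x +
        inner ℝ (c.direction.reflection (F x)) v * φ' x) := by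
    have := setIntegral_doubled c K (E := Plane) (w₁ := fun e x => inner ℝ e v * φ x)
      (w₂ := fun e x => inner ℝ (c.direction.reflection e) v * φ x) (f := F) (g := F)
      (fun x => by simp) (fun x => by simp) (fun x hx e => by simp [(hz x hx).1])
      ((h.2.1.inner_const v).integrable_mul (l2 h1 h2))
      ((((c.direction.reflection : Plane →L[ℝ] Plane).comp_memLp' h.2.1).inner_const v).integrable_mul
        (l2 h1' h2'))
    simpa only [glueGrad, inner_add_left, add_mul] using this
  rw [lhs, rhs]
  simp only [← mul_add, hder, hgrad]
  simp only [mul_add]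
  have i₁ : IntegrableOn (fun x => u x * fderiv ℝ (φ + φ') x (v - r • n)) K :=
    h.1.integrable_mul (memLp_fderiv_apply (h1.add h1') (h2.add h2') _ _)
  have i₂ : IntegrableOn (fun x => u x * fderiv ℝ (φ - φ') x (r • n)) K :=
    h.1.integrable_mul (memLp_fderiv_apply (h1.sub h1') (h2.sub h2') _ _)
  have i₃ : IntegrableOn (fun x => inner ℝ (F x) (v - r • n) * (φ + φ') x) K :=
    (h.2.1.inner_const _).integrable_mul (l2 (h1.add h1') (h2.add h2'))
  have i₄ : IntegrableOn (fun x => inner ℝ (F x) (r • n) * (φ - φ') x) K :=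
    (h.2.1.inner_const _).integrable_mul (l2 (h1.sub h1') (h2.sub h2'))
  rw [integral_add i₁ i₂, integral_add i₃ i₄, neg_add]
  exact congrArg₂ (· + ·) tangential normal

/-! ### Gluing in terms of the difference -/

/-- The fields whose extension by zero across the open edge on `c` is `H¹`. -/
def edgeVanishing (c : AffineSubspace ℝ Plane) [Nonempty c] (K : Opens Plane) :
    Submodule ℝ (SheetField K) where
  carrier := {p | GluesAlong c K p 0}
  zero_mem' := GluesAlong.zero c K
  add_mem' := fun {p q} hp hq => by
    have := GluesAlong.add hp hq
    rwa [add_zero] at this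
  smul_mem' := fun r p hp => by
    have := GluesAlong.smul r hp
    rwa [smul_zero] at this

/-- Subtracting or adding the pair `(q, q)`, glued by even reflection, passes between `(p, q)` and
`(p - q, 0)`. -/
theorem gluesAlong_iff_sub_mem {c : AffineSubspace ℝ Plane} [Nonempty c]
    (hc : Module.finrank ℝ c.direction = 1) {K : Opens Plane}
    (hb : Bornology.IsBounded (K : Set Plane)) (hK : ∀ x ∈ K, ∀ y ∈ K, c.SSameSide x y)
    (p : SheetField K) {q : SheetField K} (hq : q ∈ sobolevSpace K) :
    GluesAlong c K p q ↔ p - q ∈ edgeVanishing c K := by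
  have hqq : GluesAlong c K q q := IsSobolevPair.even_reflection hc hb hK hq
  refine ⟨fun h => ?_, fun h => ?_⟩
  · have := h.add (hqq.smul (-1))
    rwa [neg_one_smul, add_neg_cancel, ← sub_eq_add_neg] at this
  · have := GluesAlong.add h hqq
    rwa [sub_add_cancel, zero_add] at this

theorem mem_chainFormDomain_iff {a b : AffineSubspace ℝ Plane} [Nonempty a] [Nonempty b]
    {K : Opens Plane} (ha : Module.finrank ℝ a.direction = 1)
    (hb : Module.finrank ℝ b.direction = 1) (hbd : Bornology.IsBounded (K : Set Plane))
    (hKa : ∀ x ∈ K, ∀ y ∈ K, a.SSameSide x y) (hKb : ∀ x ∈ K, ∀ y ∈ K, b.SSameSide x y)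
    (D : Set Plane) {L : ℕ} (w : Fin L → SheetField K) :
    w ∈ chainFormDomain a b K D L ↔
      IsChain (sobolevVanishing K D) (edgeVanishing a K) (edgeVanishing b K) w := by
  constructor
  · rintro ⟨g1, g2, g3, g4⟩
    have hS := fun j => sobolevVanishing_le K D (g1 j)
    exact ⟨g1, fun i j e p => (gluesAlong_iff_sub_mem ha hbd hKa _ (hS j)).1 (g2 i j e p),
      fun i j e p => (gluesAlong_iff_sub_mem hb hbd hKb _ (hS j)).1 (g3 i j e p), g4⟩
  · rintro ⟨g1, g2, g3, g4⟩
    have hS := fun j => sobolevVanishing_le K D (g1 j)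
    exact ⟨g1, fun i j e p => (gluesAlong_iff_sub_mem ha hbd hKa _ (hS j)).2 (g2 i j e p),
      fun i j e p => (gluesAlong_iff_sub_mem hb hbd hKb _ (hS j)).2 (g3 i j e p), g4⟩

end MixedSpectrum

end

theorem theorem4p1
    (a b : AffineSubspace ℝ MixedSpectrum.Plane) [Nonempty a] [Nonempty b]
    (K : TopologicalSpace.Opens MixedSpectrum.Plane)
    (hK : MixedSpectrum.IsConstructionBlock a b K)
    (D : Set MixedSpectrum.Plane) (hD : D ⊆ MixedSpectrum.freeBoundary a b K)
    (n : ℕ) (hn : 1 ≤ n) :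
    MixedSpectrum.laplaceSpectrum (MixedSpectrum.chainFormDomain a b K D (2 ^ n)) =
        MixedSpectrum.laplaceSpectrum (MixedSpectrum.chainFormDomain b a K D (2 ^ n)) ∧
      ∀ l : ℝ,
        MixedSpectrum.multiplicity (MixedSpectrum.chainFormDomain a b K D (2 ^ n)) l =
          MixedSpectrum.multiplicity (MixedSpectrum.chainFormDomain b a K D (2 ^ n)) l := by
  have hL : Even (2 ^ n) := even_two.pow_of_ne_zero (by omega)
  have hab := MixedSpectrum.mem_chainFormDomain_iff hK.line_left hK.line_right hK.bounded
    (fun x hx y hy => (hK.sameSide x hx y hy).1) (fun x hx y hy => (hK.sameSide x hx y hy).2) D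
    (L := 2 ^ n)
  have hba := MixedSpectrum.mem_chainFormDomain_iff hK.line_right hK.line_left hK.bounded
    (fun x hx y hy => (hK.sameSide x hx y hy).2) (fun x hx y hy => (hK.sameSide x hx y hy).1) D
    (L := 2 ^ n)
  have h : ∀ w, MixedSpectrum.matrixAct (MixedSpectrum.pathMatrix (2 ^ n)) w ∈
      MixedSpectrum.chainFormDomain b a K D (2 ^ n) ↔
      w ∈ MixedSpectrum.chainFormDomain a b K D (2 ^ n) := fun w => by
    rw [hba, hab, MixedSpectrum.isChain_pathMatrix_iff hL]
  -- The same matrix works in both directions, since the exchange does not distinguish `a` from `b`.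
  have h' : ∀ w, MixedSpectrum.matrixAct (MixedSpectrum.pathMatrix (2 ^ n)) w ∈
      MixedSpectrum.chainFormDomain a b K D (2 ^ n) ↔
      w ∈ MixedSpectrum.chainFormDomain b a K D (2 ^ n) := fun w => by
    rw [hba, hab, MixedSpectrum.isChain_pathMatrix_iff hL]
  have hs := MixedSpectrum.pathMatrix_isSymm (2 ^ n)
  have hu := MixedSpectrum.pathMatrix_isUnit hL
  exact ⟨MixedSpectrum.laplaceSpectrum_eq_of_matrixAct hs hu h h',
    MixedSpectrum.multiplicity_eq_of_matrixAct hs hu h h'⟩
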